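/- A non-deterministic timed automaton with silent transitions (eNTA) $A$ consists of a finite set $\mathcal Q$ of locations with an initial location $q_0$, a finite set $\Sigma$ of observable actions together with a silent action $\epsilon\notin\Sigma$, a finite set $\mathcal C$ of clocks, and a finite set of transitions $(q,a,g,R,q')$, where $q,q'\in\mathcal Q$, $a\in\Sigma\cup\{\epsilon\}$, $R\subseteq\mathcal C$ is the set of clocks to be reset, and the guard $g$ is a finite conjunction of constraints $c\sim n$ with $c\in\mathcal C$, ${\sim}\in\{<,\le,=,\ge,>\}$ and $n\in\mathbb N_0$. A finite run of $A$ starts in $q_0$ with all clocks equal to $0$ and alternates delays $d_1,d_2,\dots,d_k\in\mathbb R_{\ge 0}$, during which all clocks advance at the same rate, with transitions $\tau_1,\dots,\tau_k$ of $A$ from the current location; each is taken instantaneously when its guard holds, and it sets the clocks in its reset set to $0$. If $a_i$ is the action of $\tau_i$ and $t_i=d_1+\cdots+d_i$, then the observable timed trace of the run is the sequence $(t_1,a_1),\dots,(t_k,a_k)$ with all pairs with $a_i=\epsilon$ deleted. For a set $F\subseteq\mathcal Q$ of accepting locations, the language $\mathfrak L_F(A)$ is the set of the observable timed traces of all finite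 runs of $A$ that end in a location of $F$ (when all locations are accepting, $F=\mathcal Q$). \textbf{Theorem.} The language of every eNTA $A$ is suffix-periodic: there exist a real number $t_{per}>0$ and an integer $L>0$, depending only on $A$, such that the following holds for every $F\subseteq\mathcal Q$. If $$\lambda=(t_1,a_1),\ldots,(t_{r-1},a_{r-1}),(t_r,a_r),(t_{r+1},a_{r+1}),\ldots,(t_{r+m},a_{r+m})\qquad(r\ge 1,\ m\ge 0)$$ is an observable timed trace in $\mathfrak L_F(A)$ with $t_r>t_{per}$, then for each $K\in L\mathbb Z$ with $t_r+K>t_{per}$ there exists an observable timed trace $\lambda'\in\mathfrak L_F(A)$ of the form $$\lambda'=(t'_1,a'_1),\ldots,(t'_s,a'_s),(t_r+K,a_r),(t_{r+1}+K,a_{r+1}),\ldots,(t_{r+m}+K,a_{r+m})$$ for some $s\ge 0$ and some pairs $(t'_i,a'_i)$. -/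

import Mathlib

open scoped NNReal

namespace TimedAutomata

/-- The comparison symbols `<, ≤, =, ≥, >` that may occur in a clock constraint. -/
inductive Cmp where
  | lt | le | eq | ge | gt

/-- `Cmp.Holds x r n` means that `x r n` holds, for a clock value `x` and a bound `n`. -/
def Cmp.Holds (x : ℝ≥0) : Cmp → ℕ → Prop
  | .lt, n => x < (n : ℝ≥0)
  | .le, n => x ≤ (n : ℝ≥0)
  | .eq, n => x = (n : ℝ≥0)
  | .ge, n => x ≥ (n : ℝ≥0)
  | .gt, n => x > (n : ℝ≥0)

/-- An atomic constraint `c ∼ n` on a clock `c`, with `n` a natural number. -/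
structure Constraint (C : Type*) where
  clock : C
  rel : Cmp
  bound : ℕ

/-- A guard is a finite conjunction of atomic constraints. -/
abbrev Guard (C : Type*) := List (Constraint C)

/-- A clock valuation. -/
abbrev Valuation (C : Type*) := C → ℝ≥0

/-- `v ⊨ g`: the valuation satisfies all the constraints of the guard. -/
def Valuation.Satisfies {C : Type*} (v : Valuation C) (g : Guard C) : Prop :=
  ∀ k ∈ g, Cmp.Holds (v k.clock) k.rel k.bound

/-- `v + d`: all clocks advance by `d`. -/
def Valuation.delay {C : Type*} (v : Valuation C) (d : ℝ≥0) : Valuation C :=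
  fun c => v c + d

open Classical in
/-- `v[R]`: the clocks in `R` are set to `0`, the other ones are unchanged. -/
noncomputable def Valuation.reset {C : Type*} (v : Valuation C) (R : Set C) : Valuation C :=
  fun c => if c ∈ R then 0 else v c

/-- A transition `(q, a, g, R, q')`. The action is `some a` for an observable action `a`,
and `none` for the silent action `ε`. -/
structure Transition (Q Act C : Type*) where
  source : Q
  action : Option Act
  guard : Guard C
  resets : Set C
  target : Q

/-- A non-deterministic timed automaton with silent transitions, with locations `Q`,
observable actions `Act` and clocks `C` (to be taken finite). -/
structure ENTA (Q Act C : Type*) where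
  init : Q
  transitions : Finset (Transition Q Act C)

/-- A state of the timed transition system: a location and a clock valuation. -/
abbrev State (Q C : Type*) := Q × Valuation C

namespace ENTA

variable {Q Act C : Type*}

/-- Timed transitions of the semantics: `((q, v), d, (q, v + d))`. -/
def DelayStep (s : State Q C) (d : ℝ≥0) (s' : State Q C) : Prop :=
  s' = (s.1, s.2.delay d)

/-- Discrete transitions of the semantics, taken along a transition `τ` of the automaton. -/
def Jump (A : ENTA Q Act C) (s : State Q C) (τ : Transition Q Act C) (s' : State Q C) : Prop :=
  τ ∈ A.transitions ∧ s.1 = τ.source ∧ s.2.Satisfies τ.guard ∧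
    s' = (τ.target, s.2.reset τ.resets)

/-- `A.Run s ρ s'`: there is a finite run of `A` from `s` to `s'`, alternating delays and discrete
transitions, where `ρ = [(d₁, τ₁), …, (dₖ, τₖ)]` lists the delays and the transitions taken. -/
inductive Run (A : ENTA Q Act C) :
    State Q C → List (ℝ≥0 × Transition Q Act C) → State Q C → Prop where
  | nil (s : State Q C) : Run A s [] s
  | cons {s s₁ s₂ s' : State Q C} {d : ℝ≥0} {τ : Transition Q Act C}
      {ρ : List (ℝ≥0 × Transition Q Act C)} :
      DelayStep s d s₁ → A.Jump s₁ τ s₂ → Run A s₂ ρ s' → Run A s ((d, τ) :: ρ) s'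

/-- The timed trace `(t₁, a₁), …, (tₖ, aₖ)` induced by a run that starts at absolute time `t`,
so that `tᵢ = t + d₁ + ⋯ + dᵢ`. -/
def timedTrace (t : ℝ) : List (ℝ≥0 × Transition Q Act C) → List (ℝ × Option Act)
  | [] => []
  | (d, τ) :: ρ => (t + (d : ℝ), τ.action) :: timedTrace (t + (d : ℝ)) ρ

/-- Deletes all pairs with a silent action from a timed trace. -/
def observable (w : List (ℝ × Option Act)) : List (ℝ × Act) :=
  w.filterMap fun p => p.2.map fun a => (p.1, a)

/-- The language of `A` when `F` is the set of accepting locations: all observable timed traces of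
finite runs that start in the initial state (initial location, all clocks `0`) and end in a
location of `F`. When all locations are accepting, `F = Set.univ`. -/
def language (A : ENTA Q Act C) (F : Set Q) : Set (List (ℝ × Act)) :=
  {w | ∃ (ρ : List (ℝ≥0 × Transition Q Act C)) (s : State Q C),
    A.Run (A.init, fun _ => 0) ρ s ∧ s.1 ∈ F ∧ w = observable (timedTrace 0 ρ)}

end ENTA

/-- Shifts all times of a sequence of timed actions by `K`. -/
def shift {Act : Type*} (K : ℝ) (w : List (ℝ × Act)) : List (ℝ × Act) :=
  w.map fun p => (p.1 + K, p.2)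

end TimedAutomata

/-! ### Valuations up to large clocks -/

namespace TimedAutomata

/-! Let `M` bound all guard constants. A suffix of a run, with the same delays, can be replayed from
any `CapEquiv` valuation (`Run.capEquiv`), so it suffices that `capReach` is eventually periodic in
time: the part of a run before `(t, a)` can then be exchanged for one of duration `t + K`.

Ordinary regions forget exact clock values, which the suffix needs. They can be recovered at integer
times: a run may be retimed by a time warp, since guards compare clocks only with integers, and a
suitable warp fixes the total time `n` while moving the clocks anywhere within their region
(`Reach.of_region_eq`). Hence `capReach` at time `n` depends only on the finite set of regions
reached at time `n`. By pigeonhole it agrees at some integers `i` and `i + L`, and this equality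
propagates to all later real times. -/

/-- The valuations agree on every clock, except for clocks that exceed `M` in both. -/
def CapEquiv {C : Type*} (M : ℕ) (v w : Valuation C) : Prop :=
  ∀ c, v c = w c ∨ ((M : ℝ≥0) < v c ∧ (M : ℝ≥0) < w c)

namespace CapEquiv

variable {C : Type*} {M : ℕ} {u v w : Valuation C}

theorem refl (v : Valuation C) : CapEquiv M v v := fun _ => Or.inl rfl

theorem symm (h : CapEquiv M v w) : CapEquiv M w v := fun c =>
  (h c).imp Eq.symm And.symm

theorem trans (h : CapEquiv M u v) (h' : CapEquiv M v w) : CapEquiv M u w := fun c => by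
  rcases h c with h1 | ⟨h1, h2⟩ <;> rcases h' c with h3 | ⟨h3, h4⟩
  · exact Or.inl (h1.trans h3)
  · exact Or.inr ⟨h1 ▸ h3, h4⟩
  · exact Or.inr ⟨h1, h3 ▸ h2⟩
  · exact Or.inr ⟨h1, h4⟩

theorem delay (h : CapEquiv M v w) (d : ℝ≥0) : CapEquiv M (v.delay d) (w.delay d) := fun c => by
  rcases h c with h1 | ⟨h1, h2⟩
  · exact Or.inl (by simp [Valuation.delay, h1])
  · exact Or.inr ⟨lt_of_lt_of_le h1 le_self_add, lt_of_lt_of_le h2 le_self_add⟩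

theorem reset (h : CapEquiv M v w) (R : Set C) : CapEquiv M (v.reset R) (w.reset R) := fun c => by
  by_cases hc : c ∈ R
  · exact Or.inl (by simp [Valuation.reset, hc])
  · simpa [Valuation.reset, hc] using h c

theorem satisfies (h : CapEquiv M v w) {g : Guard C} (hg : ∀ k ∈ g, k.bound ≤ M)
    (hv : v.Satisfies g) : w.Satisfies g := fun k hk => by
  rcases h k.clock with h1 | ⟨h1, h2⟩
  · exact h1 ▸ hv k hk
  · have hb : (k.bound : ℝ≥0) ≤ M := Nat.cast_le.2 (hg k hk)
    have h3 := hv k hk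
    have h4 := lt_of_le_of_lt hb h1
    have h5 := lt_of_le_of_lt hb h2
    cases hr : k.rel <;> rw [hr] at h3 <;> simp only [Cmp.Holds] at h3 ⊢
    · exact absurd h3 h4.not_gt
    · exact absurd h3 h4.not_ge
    · exact absurd h3 h4.ne'
    · exact h5.le
    · exact h5

end CapEquiv

/-! ### Reachability in a given duration -/

namespace ENTA

variable {Q Act C : Type*} {A : ENTA Q Act C}

/-- `A.Reach s T s'`: the state `s'` can be reached from `s` by delays and discrete transitions,
where the delays add up to `T`. -/
inductive Reach (A : ENTA Q Act C) (s : State Q C) : ℝ≥0 → State Q C → Prop where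
  | refl : Reach A s 0 s
  | delay {T : ℝ≥0} {q : Q} {v : Valuation C} (d : ℝ≥0) :
      Reach A s T (q, v) → Reach A s (T + d) (q, v.delay d)
  | jump {T : ℝ≥0} {s₁ s₂ : State Q C} {τ : Transition Q Act C} :
      Reach A s T s₁ → A.Jump s₁ τ s₂ → Reach A s T s₂

theorem Reach.trans {s₁ s₂ s₃ : State Q C} {T T' : ℝ≥0} (h : A.Reach s₁ T s₂)
    (h' : A.Reach s₂ T' s₃) : A.Reach s₁ (T + T') s₃ := by
  induction h' with
  | refl => simpa using h
  | delay d _ ih => rw [← add_assoc]; exact ih.delay d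
  | jump _ hj ih => exact ih.jump hj

theorem delay_delay (v : Valuation C) (d e : ℝ≥0) :
    (v.delay d).delay e = v.delay (d + e) := by
  funext c; simp [Valuation.delay, add_assoc]

theorem delay_zero (v : Valuation C) : v.delay 0 = v := by
  funext c; simp [Valuation.delay]

/-- The cut may fall inside a delay; this is why `Reach`, unlike `Run`, may stop between
transitions. -/
theorem Reach.split {s s' : State Q C} {T : ℝ≥0} (h : A.Reach s T s') :
    ∀ a b : ℝ≥0, a + b = T → ∃ s₁, A.Reach s a s₁ ∧ A.Reach s₁ b s' := by
  induction h with
  | refl =>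
    intro a b hab
    obtain ⟨rfl, rfl⟩ := add_eq_zero.1 hab
    exact ⟨s, .refl, .refl⟩
  | @delay T q v d h ih =>
    intro a b hab
    rcases le_total a T with haT | haT
    · obtain ⟨e, rfl⟩ := exists_add_of_le haT
      obtain ⟨s₁, h1, h2⟩ := ih a e rfl
      obtain rfl : b = e + d := by rw [add_assoc] at hab; exact add_left_cancel hab
      exact ⟨s₁, h1, h2.delay d⟩
    · obtain ⟨e, rfl⟩ := exists_add_of_le haT
      obtain rfl : d = e + b := by rw [add_assoc] at hab; exact (add_left_cancel hab).symm
      refine ⟨(q, v.delay e), h.delay e, ?_⟩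
      have := (Reach.refl (A := A) (s := (q, v.delay e))).delay b
      rwa [delay_delay, zero_add] at this
  | jump _ hj ih =>
    intro a b hab
    obtain ⟨s₁, h1, h2⟩ := ih a b hab
    exact ⟨s₁, h1, h2.jump hj⟩

/-- The total duration of a run. -/
def duration (ρ : List (ℝ≥0 × Transition Q Act C)) : ℝ≥0 := (ρ.map Prod.fst).sum

theorem Run.reach {s s' : State Q C} {ρ : List (ℝ≥0 × Transition Q Act C)}
    (h : A.Run s ρ s') : A.Reach s (duration ρ) s' := by
  induction h with
  | nil s => exact .refl
  | @cons s s₁ s₂ s' d τ ρ hd hj _ ih =>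
    obtain rfl : s₁ = (s.1, s.2.delay d) := hd
    have h1 : A.Reach s (0 + d) (s.1, s.2.delay d) := Reach.refl.delay d
    have := (h1.jump hj).trans ih
    simpa [duration] using this

theorem Run.append {s s₁ s' : State Q C} {ρ ρ' : List (ℝ≥0 × Transition Q Act C)}
    (h : A.Run s ρ s₁) (h' : A.Run s₁ ρ' s') : A.Run s (ρ ++ ρ') s' := by
  induction h with
  | nil => exact h'
  | cons hd hj _ ih => exact .cons hd hj (ih h')

theorem Run.of_append {s' : State Q C} {ρ ρ' : List (ℝ≥0 × Transition Q Act C)} :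
    ∀ {s : State Q C}, A.Run s (ρ ++ ρ') s' → ∃ s₁, A.Run s ρ s₁ ∧ A.Run s₁ ρ' s' := by
  induction ρ with
  | nil => exact fun h => ⟨_, .nil _, h⟩
  | cons x ρ ih =>
    intro s h
    cases h with
    | cons hd hj hr =>
      obtain ⟨s₁, h1, h2⟩ := ih hr
      exact ⟨s₁, .cons hd hj h1, h2⟩

theorem Reach.exists_run {s s' : State Q C} {T : ℝ≥0} (h : A.Reach s T s') :
    ∃ (ρ : List (ℝ≥0 × Transition Q Act C)) (s₁ : State Q C) (d : ℝ≥0),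
      A.Run s ρ s₁ ∧ duration ρ + d = T ∧ s' = (s₁.1, s₁.2.delay d) := by
  induction h with
  | refl => exact ⟨[], s, 0, .nil _, by simp [duration], by simp [delay_zero]⟩
  | delay e _ ih =>
    obtain ⟨ρ, s₁, d, h1, h2, h3⟩ := ih
    rw [Prod.mk.injEq] at h3
    exact ⟨ρ, s₁, d + e, h1, by rw [← add_assoc, h2], by rw [h3.1, h3.2, delay_delay]⟩
  | @jump T t₁ t₂ τ _ hj ih =>
    obtain ⟨ρ, s₁, d, h1, h2, h3⟩ := ih
    exact ⟨ρ ++ [(d, τ)], t₂, 0, h1.append (.cons h3 hj (.nil _)),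
      by simpa [duration] using h2, by simp [delay_zero]⟩

theorem exists_bound (A : ENTA Q Act C) :
    ∃ M : ℕ, ∀ τ ∈ A.transitions, ∀ k ∈ τ.guard, k.bound ≤ M := by
  refine ⟨A.transitions.sup fun τ => (τ.guard.map Constraint.bound).sum, fun τ hτ k hk => ?_⟩
  exact (List.single_le_sum (by simp) _ (List.mem_map_of_mem hk)).trans
    (Finset.le_sup (f := fun τ : Transition Q Act C => (τ.guard.map Constraint.bound).sum) hτ)

theorem Jump.capEquiv {M : ℕ} (hM : ∀ τ ∈ A.transitions, ∀ k ∈ τ.guard, k.bound ≤ M)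
    {s s' : State Q C} {τ : Transition Q Act C} (h : A.Jump s τ s') {w : Valuation C}
    (hw : CapEquiv M s.2 w) : ∃ w', CapEquiv M s'.2 w' ∧ A.Jump (s.1, w) τ (s'.1, w') := by
  obtain ⟨h1, h2, h3, rfl⟩ := h
  exact ⟨w.reset τ.resets, hw.reset _, h1, h2, hw.satisfies (hM τ h1) h3, rfl⟩

theorem Reach.capEquiv {M : ℕ} (hM : ∀ τ ∈ A.transitions, ∀ k ∈ τ.guard, k.bound ≤ M)
    {s s' : State Q C} {T : ℝ≥0} (h : A.Reach s T s') {w : Valuation C}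
    (hw : CapEquiv M s.2 w) : ∃ w', CapEquiv M s'.2 w' ∧ A.Reach (s.1, w) T (s'.1, w') := by
  induction h with
  | refl => exact ⟨w, hw, .refl⟩
  | delay d _ ih =>
    obtain ⟨w', h1, h2⟩ := ih
    exact ⟨w'.delay d, h1.delay d, h2.delay d⟩
  | jump _ hj ih =>
    obtain ⟨w', h1, h2⟩ := ih
    obtain ⟨w'', h3, h4⟩ := hj.capEquiv hM h1
    exact ⟨w'', h3, h2.jump h4⟩

theorem Run.capEquiv {M : ℕ} (hM : ∀ τ ∈ A.transitions, ∀ k ∈ τ.guard, k.bound ≤ M)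
    {s s' : State Q C} {ρ : List (ℝ≥0 × Transition Q Act C)} (h : A.Run s ρ s') :
    ∀ {w : Valuation C}, CapEquiv M s.2 w →
      ∃ w', CapEquiv M s'.2 w' ∧ A.Run (s.1, w) ρ (s'.1, w') := by
  induction h with
  | nil s => exact fun {w} hw => ⟨w, hw, .nil _⟩
  | @cons s s₁ s₂ s' d τ ρ hd hj _ ih =>
    intro w hw
    obtain rfl : s₁ = (s.1, s.2.delay d) := hd
    obtain ⟨w₁, h1, h2⟩ := hj.capEquiv hM (hw.delay d)
    obtain ⟨w₂, h3, h4⟩ := ih h1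
    exact ⟨w₂, h3, .cons rfl h2 h4⟩

/-! ### Time warps -/

/-- A strictly increasing map of the time axis that commutes with integer translations and
fixes `0`. -/
structure IsTimeWarp (φ : ℝ → ℝ) : Prop where
  strictMono : StrictMono φ
  add_int : ∀ (x : ℝ) (n : ℤ), φ (x + n) = φ x + n
  map_zero : φ 0 = 0

theorem IsTimeWarp.map_natCast {φ : ℝ → ℝ} (hφ : IsTimeWarp φ) (n : ℕ) : φ n = n := by
  simpa [hφ.map_zero] using hφ.add_int 0 n

/-- `T - x` is the time of the last reset. Comparing `x` with `n` amounts to comparing `T` with `T -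
x + n`, and `φ` preserves this order and commutes with adding `n`. -/
theorem IsTimeWarp.holds_iff {φ : ℝ → ℝ} (hφ : IsTimeWarp φ) {T : ℝ} {x y : ℝ≥0}
    (hy : (y : ℝ) = φ T - φ (T - x)) (r : Cmp) (n : ℕ) :
    Cmp.Holds y r n ↔ Cmp.Holds x r n := by
  have hn : φ (T - x + n) = φ (T - x) + n := by simpa using hφ.add_int (T - x) n
  have hlt : y < (n : ℝ≥0) ↔ x < (n : ℝ≥0) := by
    rw [← NNReal.coe_lt_coe, ← NNReal.coe_lt_coe, hy, NNReal.coe_natCast, sub_lt_iff_lt_add',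
      ← hn, hφ.strictMono.lt_iff_lt]
    constructor <;> intro h <;> linarith
  have hgt : (n : ℝ≥0) < y ↔ (n : ℝ≥0) < x := by
    rw [← NNReal.coe_lt_coe, ← NNReal.coe_lt_coe, hy, NNReal.coe_natCast, lt_sub_iff_add_lt',
      ← hn, hφ.strictMono.lt_iff_lt]
    constructor <;> intro h <;> linarith
  cases r
  · exact hlt
  · exact not_lt.symm.trans ((not_congr hgt).trans not_lt)
  · simp only [Cmp.Holds, le_antisymm_iff]
    rw [← not_lt, ← not_lt, hgt, hlt, not_lt, not_lt]
  · exact not_lt.symm.trans ((not_congr hlt).trans not_lt)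
  · exact hgt

theorem Reach.warp {φ : ℝ → ℝ} (hφ : IsTimeWarp φ) {q₀ : Q} {s' : State Q C} {T : ℝ≥0}
    (h : A.Reach (q₀, fun _ => 0) T s') :
    ∃ (u : Valuation C) (T' : ℝ≥0), (T' : ℝ) = φ T ∧ A.Reach (q₀, fun _ => 0) T' (s'.1, u) ∧
      ∀ c, (u c : ℝ) = φ T - φ (T - s'.2 c) := by
  induction h with
  | refl => exact ⟨fun _ => 0, 0, by simp [hφ.map_zero], .refl, by simp⟩
  | @delay T q v d _ ih =>
    obtain ⟨u, T', h1, h2, h3⟩ := ih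
    have hd : 0 ≤ φ (T + d) - φ T := sub_nonneg.2 (hφ.strictMono.monotone (by simp))
    obtain ⟨e, he⟩ : ∃ e : ℝ≥0, (e : ℝ) = φ (T + d) - φ T := ⟨⟨_, hd⟩, rfl⟩
    refine ⟨u.delay e, T' + e, ?_, h2.delay _, fun c => ?_⟩
    · rw [NNReal.coe_add, h1, he, NNReal.coe_add]; ring
    · simp only [Valuation.delay, NNReal.coe_add, he, h3 c]
      rw [add_sub_add_right_eq_sub]; ring
  | @jump T s₁ s₂ τ _ hj ih =>
    obtain ⟨u, T', h1, h2, h3⟩ := ih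
    obtain ⟨h4, h5, h6, rfl⟩ := hj
    refine ⟨u.reset τ.resets, T', h1, h2.jump ⟨h4, h5, fun k hk => ?_, rfl⟩, fun c => ?_⟩
    · exact (hφ.holds_iff (h3 k.clock) k.rel k.bound).2 (h6 k hk)
    · by_cases hc : c ∈ τ.resets
      · simp [Valuation.reset, hc]
      · simpa [Valuation.reset, hc] using h3 c

/-- A finite strictly increasing correspondence between points of `[0, 1)` that relates `0` to `0`
extends to a strictly increasing map of `[0, 1)` to itself. -/
theorem exists_strictMonoOn_extension {ι : Type*} [Finite ι] (x y : ι → ℝ)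
    (hx : ∀ i, x i ∈ Set.Ico (0 : ℝ) 1) (hy : ∀ i, y i ∈ Set.Ico (0 : ℝ) 1)
    (hxy : ∀ i j, x i ≤ x j ↔ y i ≤ y j) (i₀ : ι) (hx₀ : x i₀ = 0) (hy₀ : y i₀ = 0) :
    ∃ ψ : ℝ → ℝ, StrictMonoOn ψ (Set.Ico 0 1) ∧ Set.MapsTo ψ (Set.Ico 0 1) (Set.Ico 0 1) ∧
      ∀ i, ψ (x i) = y i := by
  classical
  have := Fintype.ofFinite ι
  -- `δ` is at most every positive gap between values `y i`, and every gap up to `1` (index `none`).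
  obtain ⟨δ, hδ, hδ1, hδy⟩ : ∃ δ : ℝ, 0 < δ ∧ (∀ i, y i + δ ≤ 1) ∧
      ∀ i j, y i < y j → y i + δ ≤ y j := by
    have key : ∀ z : Option ι × ι → ℝ, (∀ p, 0 < z p) → ∃ δ : ℝ, 0 < δ ∧ ∀ p, δ ≤ z p := by
      intro z hz
      obtain ⟨p, hp⟩ := @Finite.exists_min (Option ι × ι) _ _ ⟨(none, i₀)⟩ _ z
      exact ⟨z p, hz p, hp⟩
    obtain ⟨δ, hδ, h⟩ := key (fun p => p.1.elim (1 - y p.2)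
      fun j => if y p.2 < y j then y j - y p.2 else 1) (by
        rintro ⟨_ | j, i⟩
        · simpa using (hy i).2
        · simp only [Option.elim_some]; split_ifs with h
          · simpa using h
          · exact one_pos)
    refine ⟨δ, hδ, fun i => ?_, fun i j hij => ?_⟩
    · have := h (none, i); simp only [Option.elim_none] at this; linarith
    · have := h (some j, i); simp only [Option.elim_some, if_pos hij] at this; linarith
  have hne : ∀ t : Set.Ico (0 : ℝ) 1, (Finset.univ.filter fun i => x i ≤ t).Nonempty :=
    fun t => ⟨i₀, by simp [hx₀, t.2.1]⟩
  -- The maximum of the lines of slope `δ` issuing from the points `(x i, y i)` with `x i ≤ t`. Over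
  -- a length below `1` each rises by less than `δ`, so it cannot reach the next value of `y`.
  let ψ : ℝ → ℝ := fun t => if ht : t ∈ Set.Ico (0 : ℝ) 1 then
    (Finset.univ.filter fun i => x i ≤ t).sup' (hne ⟨t, ht⟩) fun i => y i + δ * (t - x i) else 0
  have hψ : ∀ t (ht : t ∈ Set.Ico (0 : ℝ) 1), ψ t =
    (Finset.univ.filter fun i => x i ≤ t).sup' (hne ⟨t, ht⟩) fun i => y i + δ * (t - x i) :=
    fun t ht => dif_pos ht
  have hle : ∀ t ∈ Set.Ico (0 : ℝ) 1, ∀ i, x i ≤ t → y i + δ * (t - x i) ≤ ψ t := by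
    intro t ht i hi
    rw [hψ t ht]
    exact Finset.le_sup' (fun i => y i + δ * (t - x i)) (by simpa using hi)
  have hatt : ∀ t ∈ Set.Ico (0 : ℝ) 1, ∃ i, x i ≤ t ∧ ψ t = y i + δ * (t - x i) := by
    intro t ht
    obtain ⟨i, hi, h⟩ := Finset.exists_mem_eq_sup' (hne ⟨t, ht⟩) fun i => y i + δ * (t - x i)
    exact ⟨i, by simpa using hi, by rw [hψ t ht, h]⟩
  have hsmall : ∀ t ∈ Set.Ico (0 : ℝ) 1, ∀ i, δ * (t - x i) < δ := by
    intro t ht i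
    have := (hx i).1
    have := ht.2
    nlinarith
  refine ⟨ψ, fun s hs t ht hst => ?_, fun t ht => ⟨?_, ?_⟩, fun j => ?_⟩
  · obtain ⟨i, hi, h⟩ := hatt s hs
    rw [h]
    refine lt_of_lt_of_le ?_ (hle t ht i (hi.trans hst.le))
    have := mul_lt_mul_of_pos_left (sub_lt_sub_right hst (x i)) hδ
    linarith
  · refine le_trans ?_ (hle t ht i₀ (hx₀ ▸ ht.1))
    rw [hx₀, hy₀, sub_zero, zero_add]
    exact mul_nonneg hδ.le ht.1
  · obtain ⟨i, hi, h⟩ := hatt t ht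
    have := hsmall t ht i
    have := hδ1 i
    linarith
  · refine le_antisymm ?_ (by simpa using hle (x j) (hx j) j le_rfl)
    obtain ⟨i, hi, h⟩ := hatt (x j) (hx j)
    rw [h]
    rcases ((hxy i j).1 hi).lt_or_eq with hlt | heq
    · have := hsmall (x j) (hx j) i
      have := hδy i j hlt
      linarith
    · have : x j = x i := le_antisymm ((hxy j i).2 heq.ge) hi
      rw [this, heq]; simp

/-- The extension on `[0, 1)` is repeated periodically; the extra index `none` pins `0` to `0`. -/
theorem exists_timeWarp {ι : Type*} [Finite ι] (x y : ι → ℝ)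
    (hzero : ∀ i, Int.fract (x i) = 0 ↔ Int.fract (y i) = 0)
    (hle : ∀ i j, Int.fract (x i) ≤ Int.fract (x j) ↔ Int.fract (y i) ≤ Int.fract (y j)) :
    ∃ φ : ℝ → ℝ, IsTimeWarp φ ∧ ∀ i, φ (x i) = ⌊x i⌋ + Int.fract (y i) := by
  have hmem : ∀ z : ℝ, Int.fract z ∈ Set.Ico (0 : ℝ) 1 :=
    fun z => ⟨Int.fract_nonneg z, Int.fract_lt_one z⟩
  have hz : (0 : ℝ) ∈ Set.Ico (0 : ℝ) 1 := ⟨le_rfl, one_pos⟩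
  have hnp : ∀ z : ℝ, Int.fract z ≤ 0 ↔ Int.fract z = 0 :=
    fun z => ⟨fun h => le_antisymm h (Int.fract_nonneg z), fun h => h.le⟩
  obtain ⟨ψ, hψ, hmaps, hext⟩ := exists_strictMonoOn_extension (ι := Option ι)
    (fun i => i.elim 0 fun j => Int.fract (x j)) (fun i => i.elim 0 fun j => Int.fract (y j))
    (by rintro (_ | i); exacts [hz, hmem _]) (by rintro (_ | i); exacts [hz, hmem _])
    (by
      rintro (_ | i) (_ | j)
      · simp
      · simp [Int.fract_nonneg]
      · simpa [hnp] using hzero i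
      · exact hle i j) none rfl rfl
  refine ⟨fun t => ⌊t⌋ + ψ (Int.fract t), ⟨fun s t hst => ?_, fun t n => ?_, ?_⟩, fun i => ?_⟩
  · have h1 := hmaps (hmem s)
    have h2 := hmaps (hmem t)
    rcases (Int.floor_mono hst.le).lt_or_eq with h | h
    · have : (⌊s⌋ : ℝ) + 1 ≤ ⌊t⌋ := by exact_mod_cast h
      have := h1.2
      have := h2.1
      change (⌊s⌋ : ℝ) + ψ (Int.fract s) < ⌊t⌋ + ψ (Int.fract t)
      linarith
    · have : Int.fract s < Int.fract t := by
        rw [Int.fract, Int.fract, h]; linarith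
      have := hψ (hmem s) (hmem t) this
      simp only [h]
      linarith
  · simp only [Int.floor_add_intCast, Int.fract_add_intCast, Int.cast_add]; ring
  · simpa using hext none
  · exact congrArg (fun z => (⌊x i⌋ : ℝ) + z) (hext (some i))

/-- Under the reflected warp, a clock with value `x` at an integer time `n` becomes `n + φ (x - n) =
φ x`. -/
theorem IsTimeWarp.reflect {φ : ℝ → ℝ} (hφ : IsTimeWarp φ) : IsTimeWarp fun t => -φ (-t) where
  strictMono s t h := neg_lt_neg (hφ.strictMono (neg_lt_neg h))
  add_int t n := by
    have := hφ.add_int (-t) (-n)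
    rw [Int.cast_neg] at this
    simp only [neg_add, this, neg_neg]
  map_zero := by simp [hφ.map_zero]

/-! ### Regions -/

/-- The region of a valuation: integer parts of the clocks, cut off at `M + 1`, the order of the
fractional parts, and which of these vanish. -/
noncomputable def region (M : ℕ) (v : Valuation C) :
    (C → Fin (M + 2)) × (C → C → Prop) × (C → Prop) :=
  (fun c => ⟨min ⌊(v c : ℝ)⌋₊ (M + 1), by omega⟩,
    fun c c' => Int.fract (v c : ℝ) ≤ Int.fract (v c' : ℝ), fun c => Int.fract (v c : ℝ) = 0)

theorem Reach.of_region_eq [Finite C] {M : ℕ} {q₀ q : Q} {v w : Valuation C} {n : ℕ}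
    (h : A.Reach (q₀, fun _ => 0) n (q, v)) (hvw : region M v = region M w) :
    ∃ u, CapEquiv M w u ∧ A.Reach (q₀, fun _ => 0) n (q, u) := by
  simp only [region, Prod.mk.injEq] at hvw
  obtain ⟨h1, h2, h3⟩ := hvw
  obtain ⟨φ, hφ, hext⟩ := exists_timeWarp (fun c => (v c : ℝ)) (fun c => (w c : ℝ))
    (fun c => iff_of_eq (congrFun h3 c)) (fun c c' => iff_of_eq (congrFun₂ h2 c c'))
  obtain ⟨u, T', hT', hr, hu⟩ := h.warp hφ.reflect
  have hT : T' = n := by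
    rw [← NNReal.coe_inj, hT', NNReal.coe_natCast, hφ.reflect.map_natCast]
  refine ⟨u, fun c => ?_, hT ▸ hr⟩
  have huc : (u c : ℝ) = φ (v c) := by
    have := hφ.add_int (v c) (-n)
    rw [hu c, NNReal.coe_natCast, hφ.reflect.map_natCast]
    push_cast at this
    rw [neg_sub, sub_eq_add_neg _ (n : ℝ), this]; ring
  have hfl : min ⌊(v c : ℝ)⌋₊ (M + 1) = min ⌊(w c : ℝ)⌋₊ (M + 1) := congrArg Fin.val (congrFun h1 c)
  -- Cutting at `M + 1` rather than `M` makes capped clocks exceed `M` strictly; the warp fixes `M +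
  -- 1`, so they stay above it.
  rcases le_or_gt (M + 1) ⌊(w c : ℝ)⌋₊ with hc | hc
  · have hv : M + 1 ≤ ⌊(v c : ℝ)⌋₊ := by omega
    have hv' : ((M + 1 : ℕ) : ℝ) ≤ v c := (Nat.le_floor_iff (v c).coe_nonneg).1 hv
    have hw' : ((M + 1 : ℕ) : ℝ) ≤ w c := (Nat.le_floor_iff (w c).coe_nonneg).1 hc
    have hu' : ((M + 1 : ℕ) : ℝ) ≤ u c := by
      rw [huc, ← hφ.map_natCast]; exact hφ.strictMono.monotone hv'
    have hM : (M : ℝ≥0) < ((M + 1 : ℕ) : ℝ≥0) := Nat.cast_lt.2 (Nat.lt_succ_self M)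
    exact Or.inr ⟨hM.trans_le (by exact_mod_cast hw'), hM.trans_le (by exact_mod_cast hu')⟩
  · have hv : ⌊(v c : ℝ)⌋₊ = ⌊(w c : ℝ)⌋₊ := by omega
    refine Or.inl (NNReal.coe_injective ?_)
    have hz : ⌊(v c : ℝ)⌋ = ⌊(w c : ℝ)⌋ := by
      rw [← Int.natCast_floor_eq_floor (v c).coe_nonneg, ← Int.natCast_floor_eq_floor (w c).coe_nonneg]
      rw [hv]
    rw [huc, hext c, hz, Int.floor_add_fract]

/-! ### Periodicity -/

/-- The states reachable from the initial state in time `T`, up to `CapEquiv M`. -/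
def capReach (A : ENTA Q Act C) (M : ℕ) (T : ℝ≥0) : Set (State Q C) :=
  {s | ∃ u, CapEquiv M s.2 u ∧ A.Reach (A.init, fun _ => 0) T (s.1, u)}

/-- What happens in the last `d` time units can be replayed from an equivalent state. -/
theorem capReach_add_subset {M : ℕ} (hM : ∀ τ ∈ A.transitions, ∀ k ∈ τ.guard, k.bound ≤ M)
    {T T' : ℝ≥0} (h : A.capReach M T ⊆ A.capReach M T') (d : ℝ≥0) :
    A.capReach M (T + d) ⊆ A.capReach M (T' + d) := by
  rintro s ⟨u, hu, hr⟩
  obtain ⟨s₁, h1, h2⟩ := hr.split T d rfl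
  obtain ⟨u₁, hu₁, h3⟩ := h (show s₁ ∈ A.capReach M T from ⟨s₁.2, .refl _, h1⟩)
  obtain ⟨u₂, hu₂, h4⟩ := h2.capEquiv hM hu₁
  exact ⟨u₂, hu.trans hu₂, h3.trans h4⟩

/-- Pigeonhole on the set of location-region pairs reached at each integer time. -/
theorem exists_capReach_eq [Finite Q] [Finite C] (A : ENTA Q Act C) (M : ℕ) :
    ∃ i L : ℕ, 0 < L ∧ A.capReach M i = A.capReach M (i + L : ℕ) := by
  let f : ℕ → Set (Q × (C → Fin (M + 2)) × (C → C → Prop) × (C → Prop)) := fun n =>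
    (fun s : State Q C => (s.1, region M s.2)) '' {s | A.Reach (A.init, fun _ => 0) n s}
  have key : ∀ m n : ℕ, f m = f n → A.capReach M m ⊆ A.capReach M n := by
    rintro m n hmn ⟨q, v⟩ ⟨u, hu, hr⟩
    have : (q, region M u) ∈ f n := hmn ▸ ⟨(q, u), hr, rfl⟩
    obtain ⟨⟨q', w⟩, hw, heq⟩ := this
    rw [Prod.mk.injEq] at heq
    obtain ⟨rfl, heq⟩ := heq
    obtain ⟨u', hu', h⟩ := Reach.of_region_eq hw heq
    exact ⟨u', hu.trans hu', h⟩
  obtain ⟨m, n, hne, heq⟩ := Finite.exists_ne_map_eq_of_infinite f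
  rcases hne.lt_or_gt with h | h
  · refine ⟨m, n - m, by omega, ?_⟩
    rw [Nat.add_sub_cancel' h.le]
    exact (key _ _ heq).antisymm (key _ _ heq.symm)
  · refine ⟨n, m - n, by omega, ?_⟩
    rw [Nat.add_sub_cancel' h.le]
    exact (key _ _ heq.symm).antisymm (key _ _ heq)

theorem capReach_add_mul {M : ℕ} (hM : ∀ τ ∈ A.transitions, ∀ k ∈ τ.guard, k.bound ≤ M)
    {i L : ℕ} (h : A.capReach M i = A.capReach M (i + L : ℕ)) (k : ℕ) {T : ℝ≥0}
    (hT : (i : ℝ≥0) ≤ T) : A.capReach M (T + (L * k : ℕ)) = A.capReach M T := by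
  induction k with
  | zero => simp
  | succ k ih =>
    obtain ⟨d, rfl⟩ := exists_add_of_le hT
    have h1 := (capReach_add_subset hM h.le (d + (L * k : ℕ))).antisymm
      (capReach_add_subset hM h.ge (d + (L * k : ℕ)))
    rw [← ih, add_assoc, add_assoc, h1]
    congr 1
    push_cast; ring

/-! ### Traces -/

theorem timedTrace_append (t : ℝ) (ρ ρ' : List (ℝ≥0 × Transition Q Act C)) :
    timedTrace t (ρ ++ ρ') = timedTrace t ρ ++ timedTrace (t + duration ρ) ρ' := by
  induction ρ generalizing t with
  | nil => simp [timedTrace, duration]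
  | cons x ρ ih => simp [timedTrace, duration, ih, add_assoc]

theorem observable_timedTrace_add (t K : ℝ) (ρ : List (ℝ≥0 × Transition Q Act C)) :
    observable (timedTrace (t + K) ρ) = shift K (observable (timedTrace t ρ)) := by
  induction ρ generalizing t with
  | nil => rfl
  | cons x ρ ih =>
    obtain ⟨d, τ⟩ := x
    have h := ih (t + d)
    rw [add_right_comm] at h
    cases ha : τ.action <;> simp_all [timedTrace, observable, shift, add_right_comm]

theorem exists_split_of_observable_eq {pre suf : List (ℝ × Act)} {t : ℝ} {a : Act}
    {ρ : List (ℝ≥0 × Transition Q Act C)} {t₀ : ℝ}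
    (h : observable (timedTrace t₀ ρ) = pre ++ (t, a) :: suf) :
    ∃ (ρ₁ : List (ℝ≥0 × Transition Q Act C)) (d : ℝ≥0) (τ : Transition Q Act C)
      (ρ₂ : List (ℝ≥0 × Transition Q Act C)), ρ = ρ₁ ++ (d, τ) :: ρ₂ ∧ τ.action = some a ∧
      t = t₀ + duration ρ₁ + (d : ℝ) ∧ suf = observable (timedTrace t ρ₂) := by
  induction ρ generalizing t₀ pre with
  | nil => simp [timedTrace, observable] at h
  | cons x ρ ih =>
    obtain ⟨d, τ⟩ := x
    have lift : ∀ pre' : List (ℝ × Act),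
        observable (timedTrace (t₀ + d) ρ) = pre' ++ (t, a) :: suf →
        ∃ (ρ₁ : List (ℝ≥0 × Transition Q Act C)) (d' : ℝ≥0) (τ' : Transition Q Act C)
          (ρ₂ : List (ℝ≥0 × Transition Q Act C)), (d, τ) :: ρ = ρ₁ ++ (d', τ') :: ρ₂ ∧ τ'.action = some a ∧
          t = t₀ + duration ρ₁ + (d' : ℝ) ∧ suf = observable (timedTrace t ρ₂) := by
      intro pre' h'
      obtain ⟨ρ₁, d', τ', ρ₂, h1, h2, h3, h4⟩ := ih h'
      refine ⟨(d, τ) :: ρ₁, d', τ', ρ₂, by rw [h1]; rfl, h2, ?_, h4⟩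
      rw [h3]; simp [duration]; ring
    cases ha : τ.action with
    | none =>
      refine lift pre ?_
      simpa [timedTrace, observable, ha] using h
    | some b =>
      have h' : (t₀ + (d : ℝ), b) :: observable (timedTrace (t₀ + d) ρ) =
          pre ++ (t, a) :: suf := by
        simpa [timedTrace, observable, ha] using h
      cases pre with
      | nil =>
        simp only [List.nil_append, List.cons.injEq, Prod.mk.injEq] at h'
        obtain ⟨⟨rfl, rfl⟩, h2⟩ := h'
        exact ⟨[], d, τ, ρ, rfl, ha, by simp [duration], h2.symm⟩
      | cons p pre' =>
        simp only [List.cons_append, List.cons.injEq] at h'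
        exact lift pre' h'.2

end ENTA

end TimedAutomata

/-! ### Exchanging the prefix of a run -/

theorem mainTheorem3 {Q Act C : Type*} [Finite Q] [Finite Act] [Finite C]
    (A : TimedAutomata.ENTA Q Act C) :
    ∃ (tper : ℝ) (L : ℤ), 0 < tper ∧ 0 < L ∧
      ∀ (F : Set Q) (pre : List (ℝ × Act)) (t : ℝ) (a : Act) (suf : List (ℝ × Act)),
        tper < t → pre ++ (t, a) :: suf ∈ A.language F →
        ∀ K : ℤ, L ∣ K → tper < t + (K : ℝ) →
          ∃ pre' : List (ℝ × Act),
            pre' ++ TimedAutomata.shift (K : ℝ) ((t, a) :: suf) ∈ A.language F := by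
  obtain ⟨M, hM⟩ := A.exists_bound
  obtain ⟨i, L, hL, hper⟩ := A.exists_capReach_eq M
  -- Periodicity needs only times at least `i`; the `+ 1` ensures positivity.
  refine ⟨i + 1, L, by positivity, by exact_mod_cast hL, ?_⟩
  rintro F pre t a suf ht ⟨ρ, s, hrun, hF, hobs⟩ K ⟨k, rfl⟩ htK
  obtain ⟨ρ₁, d, τ, ρ₂, rfl, hτ, htd, rfl⟩ :=
    TimedAutomata.ENTA.exists_split_of_observable_eq hobs.symm
  obtain ⟨s₁, hr₁, hr₂⟩ := hrun.of_append
  obtain ⟨T, hT⟩ : ∃ T : ℝ≥0, (T : ℝ) = t := ⟨⟨t, by linarith [i.cast_nonneg (α := ℝ)]⟩, rfl⟩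
  obtain ⟨T', hT'⟩ : ∃ T' : ℝ≥0, (T' : ℝ) = t + ((L * k : ℤ) : ℝ) :=
    ⟨⟨_, by linarith [i.cast_nonneg (α := ℝ)]⟩, rfl⟩
  have hiT : (i : ℝ≥0) ≤ T := by rw [← NNReal.coe_le_coe, hT, NNReal.coe_natCast]; linarith
  have hiT' : (i : ℝ≥0) ≤ T' := by rw [← NNReal.coe_le_coe, hT', NNReal.coe_natCast]; linarith
  have hTT' : A.capReach M T = A.capReach M T' := by
    rcases le_total 0 k with hk | hk
    · lift k to ℕ using hk
      have : T' = T + (L * k : ℕ) :=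
        NNReal.coe_injective (by push_cast; rw [hT', hT]; push_cast; ring)
      rw [this, TimedAutomata.ENTA.capReach_add_mul hM hper k hiT]
    -- For a backward shift `T'` is the earlier time, so periodicity starts from `T'`.
    · obtain ⟨j, rfl⟩ : ∃ j : ℕ, k = -j := ⟨k.natAbs, by omega⟩
      have : T = T' + (L * j : ℕ) :=
        NNReal.coe_injective (by push_cast; rw [hT', hT]; push_cast; ring)
      rw [this, TimedAutomata.ENTA.capReach_add_mul hM hper j hiT']
  cases hr₂ with
  | @cons _ s₂ s₃ _ _ _ _ hd hj hr₃ =>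
    obtain rfl : s₂ = (s₁.1, s₁.2.delay d) := hd
    have hreach : A.Reach (A.init, fun _ => 0) T (s₁.1, s₁.2.delay d) := by
      have : T = TimedAutomata.ENTA.duration ρ₁ + d :=
        NNReal.coe_injective (by rw [hT, htd]; push_cast; ring)
      rw [this]; exact hr₁.reach.delay d
    -- The run is cut after the delay `d` and just before `τ`, so the exchange happens exactly at
    -- time `t`.
    have hmem : (s₁.1, s₁.2.delay d) ∈ A.capReach M T := ⟨_, .refl _, hreach⟩
    rw [hTT'] at hmem
    obtain ⟨u, hu, hr⟩ := hmem
    obtain ⟨w, hw, hj'⟩ := hj.capEquiv hM hu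
    obtain ⟨w', _, hr₃'⟩ := hr₃.capEquiv hM hw
    obtain ⟨ρ', s₄, d', hr', hdur, hs₄⟩ := hr.exists_run
    refine ⟨TimedAutomata.ENTA.observable (TimedAutomata.ENTA.timedTrace 0 ρ'),
      ρ' ++ (d', τ) :: ρ₂, (s.1, w'), hr'.append (.cons hs₄ hj' hr₃'), hF, ?_⟩
    have hsum : (0 : ℝ) + TimedAutomata.ENTA.duration ρ' + d' = t + ((L * k : ℤ) : ℝ) := by
      rw [← hT', ← hdur]; push_cast; ring
    have hsh := TimedAutomata.ENTA.observable_timedTrace_add t ((L * k : ℤ) : ℝ) ρ₂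
    rw [TimedAutomata.ENTA.timedTrace_append, TimedAutomata.ENTA.timedTrace, hsum]
    simp only [TimedAutomata.ENTA.observable, List.filterMap_append, List.filterMap_cons, hτ,
      Option.map_some] at hsh ⊢
    rw [hsh]; rfl
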